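/- Let $1\le k<n$ be integers. Let $P_n$ be the directed path with vertices $v_1,\dots,v_n$ and edges $v_i\to v_{i-1}$ ($2\le i\le n$). Let $P=P_n^k$ be its $k$-th power: the directed graph on the same vertices with an edge $v_i\to v_j$ if and only if $1\le i-j\le k$. It has exactly one sink (vertex without outgoing edges), namely $\mathbb 1=v_1$. For an edge $v_i\to v_j$ of $P$ let $d_P(v_i,v_j)=i-j-1$ be the number of inner vertices of the longest directed path in $P$ from $v_i$ to $v_j$. The vertices arrive in a uniformly random order $\pi=(\pi_1,\dots,\pi_n)$. Let $P_{(t)}$ be the subgraph of $P$ induced by $\{\pi_1,\dots,\pi_t\}$. At time $t$ the selector knows, for all $i,j\le t$, whether $\pi_i\to\pi_j$ is an edge of $P$ and, if so, the value $d_P(\pi_i,\pi_j)$. Let $\mathcal F_t$ be the $\sigma$-algebra generated by this information. A stopping time is a map $\tau$ from the set of permutations to $\{1,\dots,n\}$ with $\{\tau=t\}\in\mathcal F_t$ for all $t\le n$. Let $c(P_{(t)})$ be the number of connected components of $P_{(t)}$ (directions of edges being ignored), and let $b_t$ be the number of vertices not in $\{\pi_1,\dots,\pi_t\}$ that lie on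 the path $P_n$ between the two extreme vertices of some connected component of $P_{(t)}$. Put $$\tau_n(\pi)=\min\bigl\{t\le n:\ n-t=k\,(c(P_{(t)})-1)+b_t \text{ and } \pi_t \text{ is a sink of } P_{(t)}\bigr\},\qquad \min\emptyset=n .$$ Then $\tau_n$ is an optimal stopping time for choosing the sink: $\tau_n$ is a stopping time, and $$\mathbb P[\pi_{\tau_n}=\mathbb 1]=\max_{\tau}\ \mathbb P[\pi_\tau=\mathbb 1],$$ where the maximum is over all stopping times $\tau$. -/

import Mathlib

open MeasureTheory ProbabilityTheory

namespace PathPower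

/-! ### Directed graphs -/

/-- `l` is a directed path from `v` to `w` in `G`: a list of distinct vertices, each joined to
the next one by an edge, that starts at `v` and ends at `w`.
The length of the path is its number of vertices, `l.length`. -/
def IsDirectedPath {V : Type*} (G : Digraph V) (v w : V) (l : List V) : Prop :=
  l.IsChain G.Adj ∧ l.Nodup ∧ l.head? = some v ∧ l.getLast? = some w

/-- The `k`-th power of a directed graph: the same vertices, with an edge from `v` to another
vertex `w` iff there is a directed path from `v` to `w` with at most `k + 1` vertices. -/
def power {V : Type*} (G : Digraph V) (k : ℕ) : Digraph V where
  Adj v w := v ≠ w ∧ ∃ l : List V, IsDirectedPath G v w l ∧ l.length ≤ k + 1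

/-- The number of inner vertices of a longest directed path of `G` from `v` to `w`, that is,
its number of vertices minus `2`. (Used only for edges `(v, w)` of a finite graph `G`.) -/
noncomputable def edgeDist {V : Type*} (G : Digraph V) (v w : V) : ℕ :=
  sSup {m : ℕ | ∃ l : List V, IsDirectedPath G v w l ∧ l.length = m} - 2

/-- The subgraph of `G` induced by a set `W` of vertices. -/
def induced {V : Type*} (G : Digraph V) (W : Set V) : Digraph W where
  Adj v w := G.Adj v w

/-- `v` is a sink (a maximal element) of `G`: it has no outgoing edge. -/
def IsSink {V : Type*} (G : Digraph V) (v : V) : Prop :=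
  ∀ w, ¬ G.Adj v w

/-- The connected components of a directed graph are those of the undirected graph
obtained by forgetting the directions of the edges. -/
abbrev Component {V : Type*} (G : Digraph V) : Type _ :=
  G.toSimpleGraphInclusive.ConnectedComponent

/-- The directed path with `n` vertices `v₁, …, vₙ` and edges `vᵢ → vᵢ₋₁`. The vertex `vᵢ`
is represented by `i - 1 : Fin n`, so that `v₁`, the end of the path, is `0`. -/
def directedPath (n : ℕ) : Digraph (Fin n) where
  Adj i j := (i : ℕ) = (j : ℕ) + 1

/-- The `k`-th power of the directed path with `n` vertices. -/
def P (n k : ℕ) : Digraph (Fin n) := power (directedPath n) k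

/-! ### The random order of arrival and what the selector sees

An outcome is a permutation `π` of the vertices. Times `1, …, n` are represented by
`Fin n`: the vertex `π t` arrives at time `t + 1`, and `n` is the last time. -/

/-- Every set of permutations is an event. -/
instance permMeasurableSpace (n : ℕ) : MeasurableSpace (Equiv.Perm (Fin n)) := ⊤

/-- All `n!` orders of arrival are equally likely. -/
noncomputable def uniformPerm (n : ℕ) : Measure (Equiv.Perm (Fin n)) :=
  uniformOn Set.univ

variable {n : ℕ}

/-- The set of the vertices that have arrived up to (and including) the arrival of `π t`. -/
def arrived (π : Equiv.Perm (Fin n)) (t : Fin n) : Set (Fin n) :=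
  {v | ∃ s, s ≤ t ∧ π s = v}

/-- What the selector knows when `π t` has arrived: for all `i, j ≤ t`, whether there is an edge
of `G` from the vertex that arrived as number `i` to the one that arrived as number `j`,
and if so, the value `d` of `edgeDist G` at this edge. -/
def observed (G : Digraph (Fin n)) (t : Fin n) (π : Equiv.Perm (Fin n)) :
    Set (Fin n × Fin n × ℕ) :=
  {x | x.1 ≤ t ∧ x.2.1 ≤ t ∧ G.Adj (π x.1) (π x.2.1) ∧ x.2.2 = edgeDist G (π x.1) (π x.2.1)}

/-- The filtration of the selector: the events at time `t` are those that are determined by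
`observed G t`. -/
def filtration (G : Digraph (Fin n)) : Filtration (Fin n) (permMeasurableSpace n) where
  seq t := MeasurableSpace.comap (observed G t) ⊤
  mono' := by
    intro s t hst
    have h : observed G s = (fun R => {x ∈ R | x.1 ≤ s ∧ x.2.1 ≤ s}) ∘ observed G t := by
      funext π
      ext x
      simp only [observed, Function.comp, Set.mem_ofPred_eq]
      constructor
      · rintro ⟨h1, h2, h3⟩
        exact ⟨⟨h1.trans hst, h2.trans hst, h3⟩, h1, h2⟩
      · rintro ⟨⟨-, -, h3⟩, h1, h2⟩
        exact ⟨h1, h2, h3⟩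
    change MeasurableSpace.comap (observed G s) ⊤ ≤ MeasurableSpace.comap (observed G t) ⊤
    rw [h, ← MeasurableSpace.comap_comp]
    exact MeasurableSpace.comap_mono le_top
  le' _ := le_top

/-- `τ`, with values in the set of the `n` times, is a stopping time of the selector. -/
def IsSelectorStoppingTime (G : Digraph (Fin n)) (τ : Equiv.Perm (Fin n) → Fin n) : Prop :=
  IsStoppingTime (filtration G) (fun π => (τ π : WithTop (Fin n)))

/-- The event that the vertex chosen by `τ` is a sink of the whole graph `G`. -/
def win (G : Digraph (Fin n)) (τ : Equiv.Perm (Fin n) → Fin n) : Set (Equiv.Perm (Fin n)) :=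
  {π | IsSink G (π (τ π))}

/-- `τ` is an optimal stopping time for choosing a sink of `G`. -/
def IsOptimal (G : Digraph (Fin n)) (τ : Equiv.Perm (Fin n) → Fin n) : Prop :=
  IsSelectorStoppingTime G τ ∧
    ∀ σ : Equiv.Perm (Fin n) → Fin n, IsSelectorStoppingTime G σ →
      uniformPerm n (win G σ) ≤ uniformPerm n (win G τ)

/-! ### The stopping time `τₙ` -/

/-- The graph `P₍ₜ₎` that is induced in `P n k` by the vertices that have arrived. -/
def visible (k : ℕ) (π : Equiv.Perm (Fin n)) (t : Fin n) : Digraph (arrived π t) :=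
  induced (P n k) (arrived π t)

/-- The number `c(P₍ₜ₎)` of connected components of the visible graph. -/
noncomputable def numComponents (k : ℕ) (π : Equiv.Perm (Fin n)) (t : Fin n) : ℕ :=
  Nat.card (Component (visible k π t))

/-- The number `bₜ` of the vertices that have not yet arrived and that lie on the path between
two vertices (equivalently, between the two extreme vertices) of the same connected component
of the visible graph. -/
noncomputable def numInner (k : ℕ) (π : Equiv.Perm (Fin n)) (t : Fin n) : ℕ :=
  Set.ncard {v : Fin n | v ∉ arrived π t ∧ ∃ C : Component (visible k π t),
    ∃ w ∈ C.supp, ∃ z ∈ C.supp, (w : Fin n) < v ∧ v < (z : Fin n)}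

/-- The vertex `π t`, as a vertex of the visible graph. -/
def current (π : Equiv.Perm (Fin n)) (t : Fin n) : arrived π t :=
  ⟨π t, t, le_rfl, rfl⟩

open Classical in
/-- The times at which the two conditions in the definition of `τₙ` hold. The time is `t + 1`. -/
noncomputable def goodTimes (k : ℕ) (π : Equiv.Perm (Fin n)) : Finset (Fin n) :=
  {t | n - ((t : ℕ) + 1) = k * (numComponents k π t - 1) + numInner k π t ∧
    IsSink (visible k π t) (current π t)}

open Classical in
/-- `τₙ`: the first good time, and the last time `n` if there is no good time. -/
noncomputable def tau (n k : ℕ) [NeZero n] (π : Equiv.Perm (Fin n)) : Fin n :=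
  if h : (goodTimes k π).Nonempty then (goodTimes k π).min' h else ⊤

end PathPower

namespace PathPower

variable {n : ℕ}

/-! ### Edges and distances in the power of the directed path -/

/-! Place the vertices on a cycle of `n + k` positions and let each arrived vertex `w` cover the arc
`[w, w + k]`; an uncovered position is free. Only differences of at most `k` are visible, so the
cycle can be cut open at any free position without changing the observation (`observed_relabel`).
The number `m` of free positions is itself determined by the observation
(`card_free_eq_of_observed_eq`), and the numerical condition in `tau` says that `m = 0`
(`layout_condition_iff`).

Let `σ` be a stopping time. Fix a time `t` and a number `m`, and consider the permutations for which
`σ` stops at `t` with `m` free positions. If `m = 0` and the sink arrives at `t`, then `tau` chooses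
it as well (`tau_eq_of_free_eq_empty`). If `m > 0`, each permutation whose sink arrives at `t`
yields, by rotation, `m` permutations whose sink is still to come, and no permutation is produced
twice (`mul_card_now_le`). On the other hand, if the sink is still to come, then it belongs to a set
of at most `m` unseen vertices that cover all free positions. If it is the last of these to arrive,
`tau` wins; swapping the sink with the last of them shows that this happens in at least one case out
of `m` (`card_later_le`). So `σ` wins at most as often as `tau` on each such class, and
`card_win_le` sums over the classes. -/

lemma IsDirectedPath.length_add {l : List (Fin n)} {v w : Fin n}
    (h : IsDirectedPath (directedPath n) v w l) : l.length + (w : ℕ) = v + 1 := by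
  obtain ⟨hc, -, hv, hw⟩ := h
  induction l generalizing v with
  | nil => simp at hv
  | cons a l ih =>
    obtain rfl : a = v := by simpa using hv
    cases l with
    | nil =>
      obtain rfl : a = w := by simpa using hw
      simp [add_comm]
    | cons b l =>
      rw [List.isChain_cons_cons] at hc
      have h1 := ih (v := b) hc.2 rfl (by simpa using hw)
      have h2 : (a : ℕ) = b + 1 := hc.1
      simp only [List.length_cons] at h1 ⊢
      omega

lemma exists_isDirectedPath {v w : Fin n} (h : w ≤ v) :
    ∃ l, IsDirectedPath (directedPath n) v w l := by
  obtain ⟨d, hd⟩ : ∃ d : ℕ, (v : ℕ) = w + d := ⟨v - w, by have : (w : ℕ) ≤ v := h; omega⟩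
  induction d generalizing v with
  | zero =>
    obtain rfl : v = w := Fin.ext (by omega)
    exact ⟨[v], by simp [IsDirectedPath]⟩
  | succ d ih =>
    obtain ⟨l, hc, hnd, hh, hl⟩ := ih (v := ⟨w + d, by omega⟩) (Fin.le_def.2 (by simp)) rfl
    -- Positions descend along the path, so the new initial vertex cannot already lie on it.
    have hle : ∀ x ∈ l, (x : ℕ) ≤ w + d := by
      clear hl hnd ih
      generalize hu : (⟨w + d, by omega⟩ : Fin n) = u at hh
      have hu' : (w : ℕ) + d = u := by rw [← hu]
      rw [hu']
      clear hu hu'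
      induction l generalizing u with
      | nil => simp
      | cons a l ih =>
        obtain rfl : a = u := by simpa using hh
        cases l with
        | nil => simp
        | cons b l =>
          rw [List.isChain_cons_cons] at hc
          have h2 : (a : ℕ) = b + 1 := hc.1
          intro x hx
          rcases List.mem_cons.1 hx with rfl | hx
          · exact le_rfl
          · have := ih hc.2 b rfl x hx
            omega
    refine ⟨v :: l, ?_, ?_, rfl, ?_⟩
    · cases l with
      | nil => simp
      | cons a l =>
        obtain rfl : a = _ := by simpa using hh
        exact List.isChain_cons_cons.2 ⟨by simp only [directedPath]; omega, hc⟩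
    · refine List.nodup_cons.2 ⟨fun hv => ?_, hnd⟩
      have := hle v hv
      omega
    · cases l with
      | nil => simp at hh
      | cons a l => simpa using hl

lemma P_adj {k : ℕ} {v w : Fin n} :
    (P n k).Adj v w ↔ (w : ℕ) < v ∧ (v : ℕ) ≤ w + k := by
  constructor
  · rintro ⟨hne, l, hl, hk⟩
    have h1 := hl.length_add
    have h2 : (v : ℕ) ≠ w := fun h => hne (Fin.ext h)
    have h3 : l ≠ [] := by rintro rfl; simpa using hl.2.2.1
    have h4 := List.length_pos_iff.2 h3
    omega
  · rintro ⟨h1, h2⟩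
    obtain ⟨l, hl⟩ := exists_isDirectedPath (v := v) (w := w) h1.le
    have h3 := hl.length_add
    exact ⟨fun h => by simp [h] at h1, l, hl, by omega⟩

lemma length_add_le_of_isDirectedPath_P {k : ℕ} {l : List (Fin n)} {v w : Fin n}
    (h : IsDirectedPath (P n k) v w l) : l.length + (w : ℕ) ≤ v + 1 := by
  obtain ⟨hc, -, hv, hw⟩ := h
  induction l generalizing v with
  | nil => simp at hv
  | cons a l ih =>
    obtain rfl : a = v := by simpa using hv
    cases l with
    | nil =>
      obtain rfl : a = w := by simpa using hw
      simp [add_comm]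
    | cons b l =>
      rw [List.isChain_cons_cons] at hc
      have h1 := ih (v := b) hc.2 rfl (by simpa using hw)
      have h2 := (P_adj.1 hc.1).1
      simp only [List.length_cons] at h1 ⊢
      omega

lemma edgeDist_P {k : ℕ} (hk : 1 ≤ k) {v w : Fin n} (h : w < v) :
    edgeDist (P n k) v w = v - w - 1 := by
  have hvw : (w : ℕ) < v := h
  obtain ⟨l, hl⟩ := exists_isDirectedPath (v := v) (w := w) h.le
  have hlen := hl.length_add
  have hmax : IsGreatest {m : ℕ | ∃ l : List (Fin n), IsDirectedPath (P n k) v w l ∧ l.length = m}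
      (v + 1 - w) := by
    refine ⟨⟨l, ⟨hl.1.imp fun a b hab => ?_, hl.2⟩, by omega⟩, ?_⟩
    · have hab' : (a : ℕ) = b + 1 := hab
      exact P_adj.2 (by omega)
    · rintro _ ⟨l', hl', rfl⟩
      have := length_add_le_of_isDirectedPath_P hl'
      omega
  rw [edgeDist, hmax.csSup_eq]
  omega

lemma isSink_P_iff [NeZero n] {k : ℕ} (hk : 1 ≤ k) {v : Fin n} : IsSink (P n k) v ↔ v = 0 := by
  constructor
  · intro h
    by_contra hv
    have hv' : (v : ℕ) ≠ 0 := fun h0 => hv (Fin.ext (by simpa using h0))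
    refine h ⟨v - 1, by omega⟩ (P_adj.2 ⟨?_, ?_⟩) <;> simp only <;> omega
  · rintro rfl w hw
    have := (P_adj.1 hw).1
    simp at this

/-! ### Free positions -/

/-- The positions in `{0, …, n + k - 1}` that are not covered by an interval `[w, w + k]`
with `w ∈ W`. -/
def free (n k : ℕ) (W : Finset ℕ) : Finset ℕ :=
  (Finset.range (n + k)).filter fun q => ∀ w ∈ W, q < w ∨ w + k < q

/-- The elements of `W` that are not followed by another one within distance `k`. -/
def tops (k : ℕ) (W : Finset ℕ) : Finset ℕ :=
  W.filter fun z => ∀ w ∈ W, w ≤ z ∨ z + k < w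

/-- The elements of `ℕ \ W` that are skipped by a pair of elements of `W` at distance at
most `k`. -/
def skipped (n k : ℕ) (W : Finset ℕ) : Finset ℕ :=
  (Finset.range n).filter fun v => v ∉ W ∧ ∃ w ∈ W, ∃ z ∈ W, w < v ∧ v < z ∧ z ≤ w + k

lemma mem_free {k q : ℕ} {W : Finset ℕ} :
    q ∈ free n k W ↔ q < n + k ∧ ∀ w ∈ W, q < w ∨ w + k < q := by
  simp [free]

lemma mem_tops {k z : ℕ} {W : Finset ℕ} :
    z ∈ tops k W ↔ z ∈ W ∧ ∀ w ∈ W, w ≤ z ∨ z + k < w := by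
  simp [tops]

lemma mem_skipped {k v : ℕ} {W : Finset ℕ} :
    v ∈ skipped n k W ↔ v < n ∧ v ∉ W ∧ ∃ w ∈ W, ∃ z ∈ W, w < v ∧ v < z ∧ z ≤ w + k := by
  simp [skipped]

lemma exists_last_le {q : ℕ} {W : Finset ℕ} (h : ∃ w ∈ W, w ≤ q) :
    ∃ w ∈ W, w ≤ q ∧ ∀ w' ∈ W, w' ≤ w ∨ q < w' := by
  obtain ⟨w, hw, hq⟩ := h
  obtain ⟨x, hx, hmax⟩ := (W.filter (· ≤ q)).exists_max_image id ⟨w, by simp [hw, hq]⟩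
  simp only [Finset.mem_filter, id] at hx hmax
  refine ⟨x, hx.1, hx.2, fun w' hw' => ?_⟩
  by_contra! h
  exact absurd (hmax w' ⟨hw', h.2⟩) (by omega)

/-- The `k` positions after each top are covered and contain neither seen nor skipped positions;
every other covered position is seen or skipped. Together with the free positions this partitions
`range (n + k)`. -/
lemma card_free_add {k : ℕ} {W : Finset ℕ} (hW : ∀ w ∈ W, w < n) :
    (free n k W).card + (W.card + (skipped n k W).card + (tops k W).card * k) = n + k := by
  classical
  set T := (tops k W ×ˢ Finset.Icc 1 k).image fun x => x.1 + x.2 with hT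
  have memT : ∀ q, q ∈ T ↔ ∃ z ∈ tops k W, z < q ∧ q ≤ z + k := by
    intro q
    simp only [hT, Finset.mem_image, Finset.mem_product, Finset.mem_Icc, Prod.exists]
    constructor
    · rintro ⟨z, i, ⟨hz, h1, h2⟩, rfl⟩
      exact ⟨z, hz, by omega, by omega⟩
    · rintro ⟨z, hz, h1, h2⟩
      exact ⟨z, q - z, ⟨hz, by omega, by omega⟩, by omega⟩
  have hTcard : T.card = (tops k W).card * k := by
    rw [hT, Finset.card_image_of_injOn, Finset.card_product]
    · simp
    · rintro ⟨z, i⟩ h1 ⟨z', i'⟩ h2 h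
      simp only [Finset.coe_product, Set.mem_prod, Finset.mem_coe, mem_tops, Finset.mem_Icc]
        at h1 h2 h
      have h3 := h1.1.2 z' h2.1.1
      have h4 := h2.1.2 z h1.1.1
      have : z = z' := by omega
      subst this
      simp only [Prod.mk.injEq, true_and]
      omega
  have hd1 : Disjoint W (skipped n k W) := by
    rw [Finset.disjoint_left]
    intro q h1 h2
    exact (mem_skipped.1 h2).2.1 h1
  have hd2 : Disjoint (W ∪ skipped n k W) T := by
    rw [Finset.disjoint_left]
    intro q h1 h2
    obtain ⟨z, hz, h3, h4⟩ := (memT q).1 h2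
    rw [mem_tops] at hz
    rcases Finset.mem_union.1 h1 with h1 | h1
    · have := hz.2 q h1
      omega
    · obtain ⟨-, -, w, hw, z', hz', h5, h6, h7⟩ := mem_skipped.1 h1
      have := hz.2 w hw
      have := hz.2 z' hz'
      omega
  have hd3 : Disjoint (free n k W) (W ∪ skipped n k W ∪ T) := by
    rw [Finset.disjoint_left]
    intro q h1 h2
    rw [mem_free] at h1
    rcases Finset.mem_union.1 h2 with h2 | h2
    · rcases Finset.mem_union.1 h2 with h2 | h2
      · have := h1.2 q h2
        omega
      · obtain ⟨-, -, w, hw, z', hz', h5, h6, h7⟩ := mem_skipped.1 h2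
        have := h1.2 w hw
        omega
    · obtain ⟨z, hz, h3, h4⟩ := (memT q).1 h2
      have := h1.2 z (mem_tops.1 hz).1
      omega
  have hU : free n k W ∪ (W ∪ skipped n k W ∪ T) = Finset.range (n + k) := by
    ext q
    simp only [Finset.mem_union, Finset.mem_range, memT]
    constructor
    · rintro (h | (h | h) | ⟨z, hz, h1, h2⟩)
      · exact (mem_free.1 h).1
      · have := hW q h
        omega
      · have := (mem_skipped.1 h).1
        omega
      · have := hW z (mem_tops.1 hz).1
        omega
    · intro hq
      by_cases hf : q ∈ free n k W
      · exact Or.inl hf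
      · refine Or.inr ?_
        rw [mem_free, not_and] at hf
        have hf' := hf hq
        push Not at hf'
        obtain ⟨w, hw, h1, h2⟩ := hf'
        by_cases hqW : q ∈ W
        · exact Or.inl (Or.inl hqW)
        obtain ⟨x, hx, hxq, hlast⟩ := exists_last_le ⟨w, hw, h1⟩
        have hne : x ≠ q := by rintro rfl; exact hqW hx
        have hwx := hlast w hw
        by_cases ht : x ∈ tops k W
        · exact Or.inr ⟨x, ht, by omega, by omega⟩
        · rw [mem_tops, not_and] at ht
          have ht' := ht hx
          push Not at ht'
          obtain ⟨z, hz, h3, h4⟩ := ht'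
          have h5 := hlast z hz
          have h6 := hW z hz
          exact Or.inl (Or.inr (mem_skipped.2
            ⟨by omega, hqW, x, hx, z, hz, by omega, by omega, h4⟩))
  rw [← hTcard, ← Finset.card_union_of_disjoint hd1, ← Finset.card_union_of_disjoint hd2,
    ← Finset.card_union_of_disjoint hd3, hU, Finset.card_range]

/-! ### Components of induced subgraphs -/

lemma induced_P_adj {k : ℕ} {A : Set (Fin n)} {v w : A} :
    (induced (P n k) A).toSimpleGraphInclusive.Adj v w ↔
      ((w : Fin n) : ℕ) ≠ (v : Fin n) ∧ ((v : Fin n) : ℕ) ≤ (w : Fin n) + k ∧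
        ((w : Fin n) : ℕ) ≤ (v : Fin n) + k := by
  have hne : v ≠ w ↔ ((w : Fin n) : ℕ) ≠ (v : Fin n) := by
    rw [Ne, Ne, Subtype.ext_iff, Fin.ext_iff, eq_comm]
  rw [Digraph.toSimpleGraphInclusive, SimpleGraph.fromRel_adj, hne]
  simp only [induced, P_adj]
  omega

/-- No edge jumps over a gap longer than `k`, so a walk that starts below such a gap stays below it.
-/
lemma le_of_reachable {k c : ℕ} {A : Set (Fin n)} {v w : A}
    (hc : ∀ x ∈ A, ∀ y ∈ A, (x : ℕ) ≤ c → c < y → (x : ℕ) + k < y)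
    (h : (induced (P n k) A).toSimpleGraphInclusive.Reachable v w)
    (hv : ((v : Fin n) : ℕ) ≤ c) : ((w : Fin n) : ℕ) ≤ c := by
  obtain ⟨p⟩ := h
  induction p with
  | nil => exact hv
  | @cons a b d hab _ ih =>
    refine ih ?_
    by_contra! hb
    have h1 := hc a a.2 b b.2 hv hb
    have h2 := induced_P_adj.1 hab
    omega

/-- A component is represented by its greatest vertex, which is a top because any vertex at most `k`
above it would be adjacent to it. Distinct tops are separated by the gap above the lower one. -/
lemma card_component {k : ℕ} {A : Set (Fin n)} {W : Finset ℕ}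
    (hW : ∀ x, x ∈ W ↔ ∃ v ∈ A, (v : ℕ) = x) :
    Nat.card (Component (induced (P n k) A)) = (tops k W).card := by
  have hmem : ∀ v : A, ((v : Fin n) : ℕ) ∈ W := fun v => (hW _).2 ⟨v, v.2, rfl⟩
  have hex : ∀ z : tops k W, ∃ v : A, ((v : Fin n) : ℕ) = z := fun z => by
    obtain ⟨v, hv, h⟩ := (hW z).1 (mem_tops.1 z.2).1
    exact ⟨⟨v, hv⟩, h⟩
  choose g hg using hex
  have key : ∀ z z' : tops k W,
      (induced (P n k) A).toSimpleGraphInclusive.Reachable (g z) (g z') → (z' : ℕ) ≤ z := by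
    intro z z' h
    have := le_of_reachable (c := z) (fun x hx y hy h1 h2 => ?_) h (hg z).le
    · rwa [hg] at this
    · have := (mem_tops.1 z.2).2 y (hmem ⟨y, hy⟩)
      omega
  have hb : Function.Bijective fun z : tops k W =>
      (induced (P n k) A).toSimpleGraphInclusive.connectedComponentMk (g z) := by
    constructor
    · intro z z' h
      have h := SimpleGraph.ConnectedComponent.exact h
      exact Subtype.ext (le_antisymm (key z' z h.symm) (key z z' h))
    · intro C
      obtain ⟨v, hv⟩ := C.nonempty_supp
      obtain ⟨u, hu, hmax⟩ := (Set.toFinite C.supp).exists_maximalFor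
        (fun u : A => ((u : Fin n) : ℕ)) _ ⟨v, hv⟩
      have hut : ((u : Fin n) : ℕ) ∈ tops k W := by
        refine mem_tops.2 ⟨hmem u, fun w hw => ?_⟩
        obtain ⟨x, hx, rfl⟩ := (hW w).1 hw
        by_contra! h
        have hadj : (induced (P n k) A).toSimpleGraphInclusive.Adj u ⟨x, hx⟩ :=
          induced_P_adj.2 ⟨by simp only; omega, by simp only; omega, h.2⟩
        have := hmax (j := ⟨x, hx⟩) (by
          rw [SimpleGraph.ConnectedComponent.mem_supp_iff] at hu ⊢
          rw [← hu]
          exact SimpleGraph.ConnectedComponent.sound hadj.reachable.symm) h.1.le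
        simp only at this
        omega
      refine ⟨⟨_, hut⟩, ?_⟩
      have : g ⟨_, hut⟩ = u := Subtype.ext (Fin.ext (hg _))
      simp only [this]
      exact hu
  rw [← Nat.card_eq_of_bijective _ hb]
  simp

/-- A missing position inside a component must be straddled by a single edge; otherwise no walk
could cross it. -/
lemma ncard_inner {k : ℕ} {A : Set (Fin n)} {W : Finset ℕ}
    (hW : ∀ x, x ∈ W ↔ ∃ v ∈ A, (v : ℕ) = x) :
    Set.ncard {v : Fin n | v ∉ A ∧ ∃ C : Component (induced (P n k) A),
      ∃ w ∈ C.supp, ∃ z ∈ C.supp, (w : Fin n) < v ∧ v < (z : Fin n)} = (skipped n k W).card := by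
  have hmem : ∀ v : A, ((v : Fin n) : ℕ) ∈ W := fun v => (hW _).2 ⟨v, v.2, rfl⟩
  rw [← Set.ncard_coe_finset, ← Set.ncard_image_of_injective _ Fin.val_injective]
  congr 1
  ext x
  simp only [Set.mem_image, Set.mem_ofPred_eq, Finset.mem_coe, mem_skipped]
  constructor
  · rintro ⟨v, ⟨hv, C, w, hw, z, hz, h1, h2⟩, rfl⟩
    have hvW : (v : ℕ) ∉ W := fun h => by
      obtain ⟨u, hu, h⟩ := (hW _).1 h
      exact hv (Fin.ext h ▸ hu)
    refine ⟨v.2, hvW, ?_⟩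
    by_contra! hno
    have hr : (induced (P n k) A).toSimpleGraphInclusive.Reachable w z :=
      SimpleGraph.ConnectedComponent.exact (hw.trans hz.symm)
    have h1' : ((w : Fin n) : ℕ) < v := h1
    have h2' : (v : ℕ) < (z : Fin n) := h2
    have := le_of_reachable (c := v) (fun x hx y hy h3 h4 => ?_) hr h1'.le
    · omega
    · have hxv : (x : ℕ) ≠ v := fun h => hvW (h ▸ hmem ⟨x, hx⟩)
      exact hno x (hmem ⟨x, hx⟩) y (hmem ⟨y, hy⟩) (by omega) h4
  · rintro ⟨hx, hxW, w, hw, z, hz, h1, h2, h3⟩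
    obtain ⟨w, hwA, rfl⟩ := (hW w).1 hw
    obtain ⟨z, hzA, rfl⟩ := (hW z).1 hz
    have hadj : (induced (P n k) A).toSimpleGraphInclusive.Adj ⟨w, hwA⟩ ⟨z, hzA⟩ :=
      induced_P_adj.2 ⟨by simp only; omega, by simp only; omega, h3⟩
    exact ⟨⟨x, hx⟩, ⟨fun h => hxW (hmem ⟨_, h⟩),
      (induced (P n k) A).toSimpleGraphInclusive.connectedComponentMk ⟨w, hwA⟩, ⟨w, hwA⟩, rfl,
      ⟨z, hzA⟩, SimpleGraph.ConnectedComponent.sound hadj.reachable.symm, h1, h2⟩, rfl⟩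

/-! ### The positions seen by the selector -/

/-- The positions of the vertices that have arrived up to time `t`. -/
def seen (π : Equiv.Perm (Fin n)) (t : Fin n) : Finset ℕ :=
  (Finset.Iic t).image fun s => (π s : ℕ)

lemma mem_seen {π : Equiv.Perm (Fin n)} {t : Fin n} {x : ℕ} :
    x ∈ seen π t ↔ ∃ s ≤ t, (π s : ℕ) = x := by
  simp [seen]

lemma val_mem_seen {π : Equiv.Perm (Fin n)} {t v : Fin n} :
    (v : ℕ) ∈ seen π t ↔ π.symm v ≤ t := by
  rw [mem_seen]
  constructor
  · rintro ⟨s, hs, h⟩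
    rwa [← Fin.ext h, Equiv.symm_apply_apply]
  · exact fun h => ⟨_, h, by simp⟩

lemma lt_of_mem_seen {π : Equiv.Perm (Fin n)} {t : Fin n} {x : ℕ} (h : x ∈ seen π t) : x < n := by
  obtain ⟨s, -, rfl⟩ := mem_seen.1 h
  exact (π s).2

lemma seen_mono (π : Equiv.Perm (Fin n)) {s t : Fin n} (h : s ≤ t) : seen π s ⊆ seen π t :=
  Finset.image_subset_image (Finset.Iic_subset_Iic.2 h)

lemma card_seen (π : Equiv.Perm (Fin n)) (t : Fin n) : (seen π t).card = t + 1 := by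
  rw [seen, Finset.card_image_of_injective _ (fun a b h => π.injective (Fin.ext h)), Fin.card_Iic]

lemma mem_seen_iff_arrived (π : Equiv.Perm (Fin n)) (t : Fin n) (x : ℕ) :
    x ∈ seen π t ↔ ∃ v ∈ arrived π t, (v : ℕ) = x := by
  rw [mem_seen]
  constructor
  · rintro ⟨s, hs, rfl⟩
    exact ⟨π s, ⟨s, hs, rfl⟩, rfl⟩
  · rintro ⟨_, ⟨s, hs, rfl⟩, rfl⟩
    exact ⟨s, hs, rfl⟩

/-- The numerical condition on a good time says that the layout of the components is known
up to their order. -/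
lemma layout_condition_iff {k : ℕ} {π : Equiv.Perm (Fin n)} {t : Fin n} :
    n - ((t : ℕ) + 1) = k * (numComponents k π t - 1) + numInner k π t ↔
      free n k (seen π t) = ∅ := by
  have h1 : numComponents k π t = (tops k (seen π t)).card :=
    card_component (mem_seen_iff_arrived π t)
  have h2 : numInner k π t = (skipped n k (seen π t)).card :=
    ncard_inner (mem_seen_iff_arrived π t)
  have h3 := card_free_add (n := n) (k := k) fun w hw => lt_of_mem_seen (π := π) (t := t) hw
  -- There is at least one component, so the subtraction `c - 1` is not truncated.
  have h4 : 0 < (tops k (seen π t)).card := by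
    rw [← h1]
    have : Nonempty (Component (visible k π t)) :=
      ⟨(visible k π t).toSimpleGraphInclusive.connectedComponentMk (current π t)⟩
    exact Nat.card_pos
  rw [card_seen] at h3
  rw [h1, h2, ← Finset.card_eq_zero]
  obtain ⟨c, hc⟩ : ∃ c, (tops k (seen π t)).card = c + 1 := ⟨_, (Nat.succ_pred_eq_of_pos h4).symm⟩
  rw [hc, add_mul, mul_comm c] at h3
  rw [hc, Nat.add_sub_cancel]
  have := t.2
  omega

lemma isSink_current_iff {k : ℕ} {π : Equiv.Perm (Fin n)} {t : Fin n} :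
    IsSink (visible k π t) (current π t) ↔ ∀ s ≤ t, ¬ (P n k).Adj (π t) (π s) := by
  constructor
  · exact fun h s hs => h ⟨π s, s, hs, rfl⟩
  · rintro h ⟨_, s, hs, rfl⟩
    exact h s hs

lemma mem_goodTimes {k : ℕ} {π : Equiv.Perm (Fin n)} {t : Fin n} :
    t ∈ goodTimes k π ↔ free n k (seen π t) = ∅ ∧ ∀ s ≤ t, ¬ (P n k).Adj (π t) (π s) := by
  classical
  unfold goodTimes
  rw [Finset.mem_filter, layout_condition_iff, isSink_current_iff]
  simp

/-- If the sink arrives at a time when nothing is free, then `τₙ` chooses it. -/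
lemma tau_eq_of_free_eq_empty [NeZero n] {k : ℕ} {π : Equiv.Perm (Fin n)} {t : Fin n}
    (ht : π t = 0) (hf : free n k (seen π t) = ∅) : tau n k π = t := by
  have hg : t ∈ goodTimes k π := by
    refine mem_goodTimes.2 ⟨hf, fun s _ h => ?_⟩
    have := (P_adj.1 h).1
    simp [ht] at this
  have hne : (goodTimes k π).Nonempty := ⟨t, hg⟩
  rw [tau, dif_pos hne]
  refine le_antisymm (Finset.min'_le _ _ hg) (Finset.le_min' _ _ _ fun s hs => ?_)
  by_contra! hst
  -- No arc covers position `0` before the sink arrives, so no earlier time is good.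
  have h0 : 0 ∈ free n k (seen π s) := by
    refine mem_free.2 ⟨by have := NeZero.pos n; omega, fun w hw => Or.inl ?_⟩
    obtain ⟨r, hr, rfl⟩ := mem_seen.1 hw
    refine Nat.pos_of_ne_zero fun h => ?_
    have : π r = π t := by rw [ht]; exact Fin.ext (by simpa using h)
    exact absurd (π.injective this) (by intro h; subst h; exact absurd hr (not_le.2 hst))
  rw [(mem_goodTimes.1 hs).1] at h0
  simp at h0

/-! ### What is determined by the observation -/

lemma observed_mono {G : Digraph (Fin n)} {π π' : Equiv.Perm (Fin n)} {s t : Fin n} (hst : s ≤ t)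
    (h : observed G t π = observed G t π') : observed G s π = observed G s π' := by
  have key : ∀ ρ, observed G s ρ = {x ∈ observed G t ρ | x.1 ≤ s ∧ x.2.1 ≤ s} := by
    intro ρ
    ext x
    simp only [observed, Set.mem_ofPred_eq]
    constructor
    · rintro ⟨h1, h2, h3⟩
      exact ⟨⟨h1.trans hst, h2.trans hst, h3⟩, h1, h2⟩
    · rintro ⟨⟨-, -, h3⟩, h1, h2⟩
      exact ⟨h1, h2, h3⟩
  rw [key, key, h]

/-- By `edgeDist_P`, an edge with value `d` is the same information as a difference `d + 1` of
positions. -/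
lemma observed_eq_iff {k : ℕ} (hk : 1 ≤ k) {π π' : Equiv.Perm (Fin n)} {t : Fin n} :
    observed (P n k) t π = observed (P n k) t π' ↔ ∀ i ≤ t, ∀ j ≤ t, ∀ d, 1 ≤ d → d ≤ k →
      ((π i : ℕ) = π j + d ↔ (π' i : ℕ) = π' j + d) := by
  have key : ∀ ρ : Equiv.Perm (Fin n), ∀ i j d, (i, j, d) ∈ observed (P n k) t ρ ↔
      i ≤ t ∧ j ≤ t ∧ (ρ i : ℕ) = ρ j + (d + 1) ∧ d + 1 ≤ k := by
    intro ρ i j d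
    simp only [observed, Set.mem_ofPred_eq, P_adj]
    refine and_congr_right fun _ => and_congr_right fun _ => ?_
    constructor
    · rintro ⟨⟨h1, h2⟩, rfl⟩
      rw [edgeDist_P hk h1]
      omega
    · rintro ⟨h1, h2⟩
      have h3 : ρ j < ρ i := Fin.lt_def.2 (by omega)
      rw [edgeDist_P hk h3]
      omega
  constructor
  · intro h i hi j hj d hd hdk
    have h1 : (i, j, d - 1) ∈ observed (P n k) t π ↔ (i, j, d - 1) ∈ observed (P n k) t π' := by
      rw [h]
    rw [key, key, Nat.sub_add_cancel hd] at h1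
    simpa [hi, hj, hdk] using h1
  · intro h
    ext ⟨i, j, d⟩
    rw [key, key]
    constructor
    · rintro ⟨hi, hj, h1, h2⟩
      exact ⟨hi, hj, (h i hi j hj _ (by omega) h2).1 h1, h2⟩
    · rintro ⟨hi, hj, h1, h2⟩
      exact ⟨hi, hj, (h i hi j hj _ (by omega) h2).2 h1, h2⟩

lemma adj_iff_of_observed_eq {k : ℕ} (hk : 1 ≤ k) {π π' : Equiv.Perm (Fin n)} {t : Fin n}
    (h : observed (P n k) t π = observed (P n k) t π') {i j : Fin n} (hi : i ≤ t) (hj : j ≤ t) :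
    (P n k).Adj (π i) (π j) ↔ (P n k).Adj (π' i) (π' j) := by
  rw [observed_eq_iff hk] at h
  rw [P_adj, P_adj]
  constructor
  · intro h1
    have := (h i hi j hj (π i - π j) (by omega) (by omega)).1 (by omega)
    omega
  · intro h1
    have := (h i hi j hj (π' i - π' j) (by omega) (by omega)).2 (by omega)
    omega

open Classical in
/-- The positions that are not free, counted by the last arrived vertex before them. -/
lemma card_free_eq {k : ℕ} (π : Equiv.Perm (Fin n)) (t : Fin n) :
    (free n k (seen π t)).card + ((Finset.Iic t ×ˢ Finset.range (k + 1)).filter fun x =>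
      ∀ s ≤ t, ∀ d, 1 ≤ d → d ≤ x.2 → (π s : ℕ) ≠ π x.1 + d).card = n + k := by
  set Q := (Finset.Iic t ×ˢ Finset.range (k + 1)).filter fun x =>
      ∀ s ≤ t, ∀ d, 1 ≤ d → d ≤ x.2 → (π s : ℕ) ≠ π x.1 + d with hQ
  have hmemQ : ∀ s i, (s, i) ∈ Q ↔ s ≤ t ∧ i ≤ k ∧
      ∀ s' ≤ t, (π s' : ℕ) ≤ π s ∨ (π s : ℕ) + i < π s' := by
    intro s i
    simp only [hQ, Finset.mem_filter, Finset.mem_product, Finset.mem_Iic, Finset.mem_range,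
      Nat.lt_succ_iff, and_assoc]
    refine and_congr_right fun _ => and_congr_right fun _ => ?_
    constructor
    · intro h s' hs'
      by_contra! hlt
      exact h s' hs' (π s' - π s) (by omega) (by omega) (by omega)
    · intro h s' hs' d h1 h2 h3
      have := h s' hs'
      omega
  rw [← Finset.card_range (n + k),
    ← Finset.card_sdiff_add_card_eq_card
      (show free n k (seen π t) ⊆ Finset.range (n + k) from Finset.filter_subset _ _), add_comm]
  congr 1
  refine Finset.card_bij (fun x _ => (π x.1 : ℕ) + x.2) ?_ ?_ ?_
  · rintro ⟨s, i⟩ h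
    obtain ⟨h1, h2, -⟩ := (hmemQ s i).1 h
    have := (π s).2
    simp only [Finset.mem_sdiff, Finset.mem_range, mem_free, not_and]
    refine ⟨by omega, fun _ hall => ?_⟩
    have := hall (π s) (mem_seen.2 ⟨s, h1, rfl⟩)
    omega
  · rintro ⟨s, i⟩ h ⟨s', i'⟩ h' heq
    obtain ⟨h1, h2, h3⟩ := (hmemQ s i).1 h
    obtain ⟨h1', h2', h3'⟩ := (hmemQ s' i').1 h'
    have ha := h3 s' h1'
    have hb := h3' s h1
    simp only at heq
    have : s = s' := π.injective (Fin.ext (by omega))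
    subst this
    simp only [Prod.mk.injEq, true_and]
    omega
  · intro q hq
    simp only [Finset.mem_sdiff, Finset.mem_range, mem_free, not_and] at hq
    have hq2 := hq.2 hq.1
    push Not at hq2
    obtain ⟨w, hw, h1, h2⟩ := hq2
    obtain ⟨x, hx, hxq, hlast⟩ := exists_last_le ⟨w, hw, h1⟩
    have := hlast w hw
    obtain ⟨s, hs, rfl⟩ := mem_seen.1 hx
    refine ⟨(s, q - π s), (hmemQ _ _).2 ⟨hs, by omega, fun s' hs' => ?_⟩, by simp only; omega⟩
    have := hlast (π s') (mem_seen.2 ⟨s', hs', rfl⟩)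
    omega

/-- The pairs counted in `card_free_eq` are defined by differences of at most `k`, all of which are
observed. -/
lemma card_free_eq_of_observed_eq {k : ℕ} (hk : 1 ≤ k) {π π' : Equiv.Perm (Fin n)} {t : Fin n}
    (h : observed (P n k) t π = observed (P n k) t π') :
    (free n k (seen π t)).card = (free n k (seen π' t)).card := by
  classical
  have h1 := card_free_eq (k := k) π t
  have h2 := card_free_eq (k := k) π' t
  rw [observed_eq_iff hk] at h
  rw [Finset.filter_congr (q := fun x => ∀ s ≤ t, ∀ d, 1 ≤ d → d ≤ x.2 → (π' s : ℕ) ≠ π' x.1 + d)]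
    at h1
  · omega
  · rintro ⟨s, i⟩ hx
    simp only [Finset.mem_product, Finset.mem_Iic, Finset.mem_range] at hx
    refine forall₂_congr fun s' hs' => forall_congr' fun d => forall₂_congr fun hd hdi => ?_
    exact not_congr (h s' hs' s hx.1 d hd (by simp only at hdi; omega))

lemma mem_goodTimes_of_observed_eq {k : ℕ} (hk : 1 ≤ k) {π π' : Equiv.Perm (Fin n)} {t : Fin n}
    (h : observed (P n k) t π = observed (P n k) t π') (hg : t ∈ goodTimes k π) :
    t ∈ goodTimes k π' := by
  rw [mem_goodTimes, ← Finset.card_eq_zero] at hg ⊢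
  rw [← card_free_eq_of_observed_eq hk h]
  exact ⟨hg.1, fun s hs => (adj_iff_of_observed_eq hk h le_rfl hs).not.1 (hg.2 s hs)⟩

/-! ### Stopping times in terms of observations -/

lemma tau_le_iff [NeZero n] {k : ℕ} {π : Equiv.Perm (Fin n)} {t : Fin n} :
    tau n k π ≤ t ↔ t = ⊤ ∨ ∃ s ≤ t, s ∈ goodTimes k π := by
  rw [tau]
  split_ifs with h
  · constructor
    · exact fun hle => Or.inr ⟨_, hle, Finset.min'_mem _ _⟩
    · rintro (rfl | ⟨s, hs, hg⟩)
      · exact le_top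
      · exact (Finset.min'_le _ _ hg).trans hs
  -- The default value `⊤` is what the disjunct `t = ⊤` accounts for.
  · rw [top_le_iff]
    refine ⟨Or.inl, fun h' => h'.resolve_right ?_⟩
    rintro ⟨s, -, hg⟩
    exact h ⟨s, hg⟩

lemma measurableSet_filtration_iff {G : Digraph (Fin n)} {t : Fin n}
    {E : Set (Equiv.Perm (Fin n))} :
    MeasurableSet[filtration G t] E ↔
      ∀ π π', observed G t π = observed G t π' → π ∈ E → π' ∈ E := by
  change MeasurableSet[MeasurableSpace.comap (observed G t) ⊤] E ↔ _
  rw [MeasurableSpace.measurableSet_comap]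
  constructor
  · rintro ⟨A, -, rfl⟩ π π' h hπ
    rw [Set.mem_preimage] at hπ ⊢
    rwa [← h]
  · intro h
    refine ⟨observed G t '' E, trivial, ?_⟩
    ext π
    constructor
    · rintro ⟨π', h', heq⟩
      exact h _ _ heq h'
    · exact fun h' => ⟨π, h', rfl⟩

lemma isSelectorStoppingTime_iff {G : Digraph (Fin n)} {τ : Equiv.Perm (Fin n) → Fin n} :
    IsSelectorStoppingTime G τ ↔
      ∀ t π π', observed G t π = observed G t π' → τ π ≤ t → τ π' ≤ t := by
  simp only [IsSelectorStoppingTime, IsStoppingTime, measurableSet_filtration_iff,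
    Set.mem_ofPred_eq, WithTop.coe_le_coe]

lemma isSelectorStoppingTime_tau [NeZero n] {k : ℕ} (hk : 1 ≤ k) :
    IsSelectorStoppingTime (P n k) (tau n k) := by
  rw [isSelectorStoppingTime_iff]
  intro t π π' h
  rw [tau_le_iff, tau_le_iff]
  refine Or.imp_right ?_
  rintro ⟨s, hs, hg⟩
  exact ⟨s, hs, mem_goodTimes_of_observed_eq hk (observed_mono hs h) hg⟩

/-- Equal observations at time `τ π` force `τ π' ≤ τ π`; the observations then also agree at time `τ
π'`, which gives the reverse inequality. -/
lemma IsSelectorStoppingTime.eq_of_observed_eq {G : Digraph (Fin n)}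
    {τ : Equiv.Perm (Fin n) → Fin n} (hτ : IsSelectorStoppingTime G τ)
    {π π' : Equiv.Perm (Fin n)} (h : observed G (τ π) π = observed G (τ π) π') :
    τ π' = τ π := by
  rw [isSelectorStoppingTime_iff] at hτ
  have hle : τ π' ≤ τ π := hτ _ _ _ h le_rfl
  exact le_antisymm hle (hτ _ _ _ (observed_mono hle h.symm) le_rfl)

/-! ### Rotations of the layout -/

/-- The rotation of the cycle `{0, …, N - 1}` that moves `p` to `0`. -/
def rot (N p v : ℕ) : ℕ := if v < p then v + N - p else v - p

/-- A vertex `w` of `W` below the free position `p` satisfies `w + k < p`, so it wraps around to `w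
+ n + k - p < n`. Rotation thus keeps `W` among the vertices, and the other vertices can be mapped
by any bijective extension. -/
lemma exists_relabel {k p : ℕ} {W : Finset ℕ} (hp : p ∈ free n k W) :
    ∃ φ : Equiv.Perm (Fin n), ∀ v : Fin n, (v : ℕ) ∈ W → (φ v : ℕ) = rot (n + k) p v := by
  rw [mem_free] at hp
  have hlt : ∀ v : {v : Fin n // (v : ℕ) ∈ W}, rot (n + k) p v < n := by
    rintro ⟨v, hv⟩
    have := hp.2 v hv
    unfold rot
    simp only
    split_ifs <;> omega
  obtain ⟨φ, hφ⟩ := Equiv.Perm.exists_extending_pair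
    (fun v : {v : Fin n // (v : ℕ) ∈ W} => (v : Fin n)) (fun v => ⟨rot (n + k) p v, hlt v⟩)
    Subtype.val_injective (by
      rintro ⟨v, hv⟩ ⟨w, hw⟩ h
      simp only [Fin.mk.injEq, rot] at h
      refine Subtype.ext (Fin.ext ?_)
      simp only
      split_ifs at h <;> omega)
  exact ⟨φ, fun v hv => by rw [hφ ⟨v, hv⟩]⟩

open Classical in
/-- A permutation of the vertices that rotates those in `W` so that `p` would become `0`. -/
noncomputable def relabel (n k : ℕ) (W : Finset ℕ) (p : ℕ) : Equiv.Perm (Fin n) :=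
  if h : p ∈ free n k W then (exists_relabel h).choose else 1

lemma relabel_apply {k p : ℕ} {π : Equiv.Perm (Fin n)} {s t : Fin n} (hst : s ≤ t)
    (hp : p ∈ free n k (seen π t)) :
    (relabel n k (seen π t) p (π s) : ℕ) = rot (n + k) p (π s) := by
  rw [relabel, dif_pos hp]
  exact (exists_relabel hp).choose_spec _ (mem_seen.2 ⟨s, hst, rfl⟩)

/-- Seen vertices at distance at most `k` lie on the same side of `p` and keep their difference. For
`v < p < w` the new distance is `v + n + k - w > k`: the `k` extra positions of the cycle prevent
new edges. -/
lemma observed_relabel {k p : ℕ} (hk : 1 ≤ k) {π : Equiv.Perm (Fin n)} {t : Fin n}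
    (hp : p ∈ free n k (seen π t)) :
    observed (P n k) t π = observed (P n k) t (π.trans (relabel n k (seen π t) p)) := by
  rw [observed_eq_iff hk]
  intro i hi j hj d hd hdk
  rw [Equiv.trans_apply, Equiv.trans_apply, relabel_apply hi hp, relabel_apply hj hp]
  have h1 := (mem_free.1 hp).2 (π i) (mem_seen.2 ⟨i, hi, rfl⟩)
  have h2 := (mem_free.1 hp).2 (π j) (mem_seen.2 ⟨j, hj, rfl⟩)
  have h3 := (π i).2
  have h4 := (π j).2
  have h5 := (mem_free.1 hp).1
  unfold rot
  split_ifs <;> omega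

/-! ### Comparison of stopping at the sink with waiting -/

lemma lt_of_mem_free_of_now {k p : ℕ} [NeZero n] {π : Equiv.Perm (Fin n)} {t : Fin n}
    (ht : π t = 0) (hp : p ∈ free n k (seen π t)) : k < p := by
  have := (mem_free.1 hp).2 (π t) (mem_seen.2 ⟨t, le_rfl, rfl⟩)
  rw [ht, Fin.val_zero] at this
  omega

/-- Among the permutations with the same observation, those for which the sink has not arrived
are at least `m` times as many as those for which it has just arrived. -/
lemma mul_card_now_le [NeZero n] {k m : ℕ} (hk : 1 ≤ k) {t : Fin n}
    (E : Finset (Equiv.Perm (Fin n)))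
    (hE : ∀ π π', observed (P n k) t π = observed (P n k) t π' → π ∈ E → π' ∈ E)
    (hm : ∀ π ∈ E, (free n k (seen π t)).card = m) :
    m * (E.filter fun π => π t = 0).card ≤ (E.filter fun π => 0 ∉ seen π t).card := by
  classical
  have hcard : ((E.filter fun π => π t = 0).sigma fun π => free n k (seen π t)).card =
      m * (E.filter fun π => π t = 0).card := by
    rw [Finset.card_sigma, Finset.sum_congr rfl fun π hπ => hm π (Finset.mem_filter.1 hπ).1,
      Finset.sum_const, smul_eq_mul, mul_comm]
  rw [← hcard]
  refine Finset.card_le_card_of_injOn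
    (fun x => x.1.trans (relabel n k (seen x.1 t) x.2)) ?_ ?_
  · rintro ⟨π, p⟩ hx
    simp only [Finset.coe_sigma, Set.mem_sigma_iff, Finset.mem_coe, Finset.mem_filter] at hx
    obtain ⟨⟨hπ, ht⟩, hp⟩ := hx
    simp only [Finset.coe_filter, Set.mem_ofPred_eq]
    refine ⟨hE _ _ (observed_relabel hk hp) hπ, fun h0 => ?_⟩
    -- Only `p` is rotated to `0`, and a free position is not seen.
    obtain ⟨s, hs, h⟩ := mem_seen.1 h0
    rw [Equiv.trans_apply, relabel_apply hs hp] at h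
    have h1 := (mem_free.1 hp).2 (π s) (mem_seen.2 ⟨s, hs, rfl⟩)
    have h2 := (mem_free.1 hp).1
    unfold rot at h
    split_ifs at h <;> omega
  · rintro ⟨π, p⟩ hx ⟨π', p'⟩ hx' heq
    simp only [Finset.coe_sigma, Set.mem_sigma_iff, Finset.mem_coe, Finset.mem_filter] at hx hx'
    obtain ⟨⟨hπ, ht⟩, hp⟩ := hx
    obtain ⟨⟨hπ', ht'⟩, hp'⟩ := hx'
    simp only at heq hp hp' ht ht'
    have happ : ∀ s ≤ t, rot (n + k) p (π s) = rot (n + k) p' (π' s) := by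
      intro s hs
      have := congrArg (fun ρ : Equiv.Perm (Fin n) => (ρ s : ℕ)) heq
      simpa only [Equiv.trans_apply, relabel_apply hs hp, relabel_apply hs hp'] using this
    -- The sink is sent to `n + k - p`, which determines `p`.
    have hpp : p = p' := by
      have h1 := happ t le_rfl
      have h2 := lt_of_mem_free_of_now ht hp
      have h3 := lt_of_mem_free_of_now ht' hp'
      have h4 := (mem_free.1 hp).1
      have h5 := (mem_free.1 hp').1
      rw [ht, ht', Fin.val_zero, rot, rot, if_pos (by omega), if_pos (by omega)] at h1
      omega
    subst hpp
    have hseen : seen π t = seen π' t := by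
      refine Finset.image_congr fun s hs => ?_
      have hs : s ≤ t := by simpa using hs
      have h1 := happ s hs
      have h2 := (mem_free.1 hp).1
      have h3 := (π s).2
      have h4 := (π' s).2
      unfold rot at h1
      split_ifs at h1 <;> omega
    -- The relabelling depends only on the seen set and on `p`, so it is now the same on both sides
    -- and cancels.
    rw [hseen] at heq
    have : π = π' := by
      ext s
      have := congrArg (fun ρ : Equiv.Perm (Fin n) => ρ s) heq
      simp only [Equiv.trans_apply, EmbeddingLike.apply_eq_iff_eq] at this
      rw [this]
    rw [this]

/-! ### Covering the free positions by later arrivals -/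

/-- Vertices, as many as the free positions, after whose arrival nothing is free. -/
def closing (n k : ℕ) (W : Finset ℕ) : Finset ℕ :=
  (free n k W).image fun p => if ∃ w ∈ W, p < w then p else p - k

lemma not_mem_of_mem_closing {k x : ℕ} {W : Finset ℕ} (hx : x ∈ closing n k W) : x ∉ W := by
  intro hW
  obtain ⟨p, hp, rfl⟩ := Finset.mem_image.1 hx
  rw [mem_free] at hp
  have := hp.2 _ hW
  split_ifs at this with h
  · omega
  · push Not at h
    split_ifs at hW with h'
    · obtain ⟨w, hw, h1⟩ := h'
      exact absurd (h w hw) (by omega)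
    · have := h _ hW
      omega

lemma zero_mem_closing {k : ℕ} {W : Finset ℕ} [NeZero n] (hW : W.Nonempty) (h0 : 0 ∉ W) :
    0 ∈ closing n k W := by
  have hpos : ∀ w ∈ W, 0 < w := fun w hw => Nat.pos_of_ne_zero (by rintro rfl; exact h0 hw)
  obtain ⟨w, hw⟩ := hW
  refine Finset.mem_image.2 ⟨0, mem_free.2 ⟨by have := NeZero.pos n; omega,
    fun w hw => Or.inl (hpos w hw)⟩, ?_⟩
  rw [if_pos ⟨w, hw, hpos w hw⟩]

/-- A free position beyond all of `W` may be `n` or larger; this is why `closing` uses `p - k`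
there. -/
lemma lt_of_mem_closing [NeZero n] {k x : ℕ} {W : Finset ℕ} (hW : ∀ w ∈ W, w < n)
    (hx : x ∈ closing n k W) : x < n := by
  obtain ⟨p, hp, rfl⟩ := Finset.mem_image.1 hx
  have h1 := (mem_free.1 hp).1
  have := NeZero.pos n
  split_ifs with h
  · obtain ⟨w, hw, h2⟩ := h
    have := hW w hw
    omega
  · omega

/-- A position free for `U` is free for `W`, and the arc of its closing vertex covers it, either as
first or as last point. -/
lemma free_eq_empty_of_closing_subset {k : ℕ} {W U : Finset ℕ} (hne : W.Nonempty) (hWU : W ⊆ U)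
    (h : closing n k W ⊆ U) : free n k U = ∅ := by
  rw [Finset.eq_empty_iff_forall_notMem]
  intro q hq
  rw [mem_free] at hq
  have hqW : q ∈ free n k W := mem_free.2 ⟨hq.1, fun w hw => hq.2 w (hWU hw)⟩
  have h1 := hq.2 _ (h (Finset.mem_image_of_mem _ hqW))
  obtain ⟨w, hw⟩ := hne
  have h2 := hq.2 w (hWU hw)
  split_ifs at h1 with h3
  · omega
  · push Not at h3
    have := h3 w hw
    omega

/-- Among the permutations for which the sink has not arrived, at least one in `m` wins. -/
lemma card_later_le [NeZero n] {k m : ℕ} (hk : 1 ≤ k) {t : Fin n}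
    (E : Finset (Equiv.Perm (Fin n)))
    (hE : ∀ π π', observed (P n k) t π = observed (P n k) t π' → π ∈ E → π' ∈ E)
    (hm : ∀ π ∈ E, (free n k (seen π t)).card = m) :
    (E.filter fun π => 0 ∉ seen π t).card ≤ m * (E.filter fun π => π (tau n k π) = 0).card := by
  classical
  have hne : ∀ π : Equiv.Perm (Fin n), (seen π t).Nonempty :=
    fun π => ⟨π t, mem_seen.2 ⟨t, le_rfl, rfl⟩⟩
  -- The closing vertex that arrives last. The implication makes the choice total; its value is
  -- irrelevant when the sink has been seen.
  have hlast : ∀ π : Equiv.Perm (Fin n), ∃ s : Fin n, 0 ∉ seen π t →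
      (s : ℕ) ∈ closing n k (seen π t) ∧
        ∀ s' : Fin n, (s' : ℕ) ∈ closing n k (seen π t) → π.symm s' ≤ π.symm s := by
    intro π
    by_cases h0 : 0 ∈ seen π t
    · exact ⟨0, fun h => absurd h0 h⟩
    · obtain ⟨s, hs, hmax⟩ := (Finset.univ.filter fun s : Fin n =>
        (s : ℕ) ∈ closing n k (seen π t)).exists_max_image π.symm
          ⟨0, by simpa using zero_mem_closing (hne π) h0⟩
      simp only [Finset.mem_filter, Finset.mem_univ, true_and] at hs hmax
      exact ⟨s, fun _ => ⟨hs, hmax⟩⟩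
  choose g hg using hlast
  set f : Equiv.Perm (Fin n) → Equiv.Perm (Fin n) := fun π => π.trans (Equiv.swap 0 (g π)) with hf
  have hfix : ∀ π, 0 ∉ seen π t → ∀ s ≤ t, f π s = π s := by
    intro π h0 s hs
    have h1 : (π s : ℕ) ∈ seen π t := mem_seen.2 ⟨s, hs, rfl⟩
    rw [hf, Equiv.trans_apply, Equiv.swap_apply_of_ne_of_ne]
    · intro h
      rw [h, Fin.val_zero] at h1
      exact h0 h1
    · intro h
      rw [h] at h1
      exact not_mem_of_mem_closing (hg π h0).1 h1
  have hseen : ∀ π, 0 ∉ seen π t → seen (f π) t = seen π t := fun π h0 =>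
    Finset.image_congr fun s hs => by
      rw [hfix π h0 s (by simpa using hs)]
  have hobs : ∀ π, 0 ∉ seen π t → observed (P n k) t π = observed (P n k) t (f π) := by
    intro π h0
    rw [observed_eq_iff hk]
    intro i hi j hj d _ _
    rw [hfix π h0 i hi, hfix π h0 j hj]
  have hwin : ∀ π, 0 ∉ seen π t → f π (tau n k (f π)) = 0 := by
    intro π h0
    have h1 : f π (π.symm (g π)) = 0 := by simp [hf]
    -- After the swap the sink is the last closing vertex to arrive, so nothing is free at its
    -- arrival.
    have hsymm : ∀ x : Fin n, (x : ℕ) ∈ closing n k (seen π t) →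
        (f π).symm x ≤ π.symm (g π) := by
      intro x hx
      rw [hf, Equiv.symm_trans_apply, Equiv.symm_swap]
      refine (hg π h0).2 _ ?_
      rw [Equiv.swap_apply_def]
      split_ifs
      · exact (hg π h0).1
      · exact zero_mem_closing (hne π) h0
      · exact hx
    have hlt : t ≤ π.symm (g π) := by
      by_contra! h
      exact not_mem_of_mem_closing (hg π h0).1 (val_mem_seen.2 h.le)
    rw [tau_eq_of_free_eq_empty h1 (free_eq_empty_of_closing_subset (hne π) ?_ ?_), h1]
    · rw [← hseen π h0]
      exact seen_mono _ hlt
    · intro x hx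
      have hxn := lt_of_mem_closing (fun w hw => lt_of_mem_seen hw) hx
      exact val_mem_seen.2 (hsymm ⟨x, hxn⟩ hx)
  refine (Finset.card_le_mul_card_image (f := f) _ m ?_).trans
    (Nat.mul_le_mul_left m (Finset.card_le_card ?_))
  -- A preimage `c` is recovered from its image by swapping `0` with `g c`. The swap leaves the seen
  -- set unchanged, so `g c` is one of at most `m` closing vertices.
  · intro b hb
    obtain ⟨a, ha, rfl⟩ := Finset.mem_image.1 hb
    obtain ⟨haE, ha0⟩ := Finset.mem_filter.1 ha
    have hT : (Finset.univ.filter fun s : Fin n =>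
        (s : ℕ) ∈ closing n k (seen (f a) t)).card ≤ m := by
      rw [← hm a haE, ← hseen a ha0]
      refine (Finset.card_le_card_of_injOn (t := closing n k (seen (f a) t))
        (fun s : Fin n => (s : ℕ)) ?_ Fin.val_injective.injOn).trans Finset.card_image_le
      intro s hs
      simpa using hs
    refine le_trans (Finset.card_le_card ?_) (Finset.card_image_le
      (f := fun s => (f a).trans (Equiv.swap 0 s)) |>.trans hT)
    intro c hc
    obtain ⟨hc, hca⟩ := Finset.mem_filter.1 hc
    have hc0 := (Finset.mem_filter.1 hc).2
    refine Finset.mem_image.2 ⟨g c, ?_, ?_⟩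
    · rw [Finset.mem_filter, ← hca, hseen c hc0]
      exact ⟨Finset.mem_univ _, (hg c hc0).1⟩
    · rw [← hca]
      ext x
      simp [hf]
  · intro b hb
    obtain ⟨a, ha, rfl⟩ := Finset.mem_image.1 hb
    obtain ⟨haE, ha0⟩ := Finset.mem_filter.1 ha
    exact Finset.mem_filter.2 ⟨hE _ _ (hobs a ha0) haE, hwin a ha0⟩

/-! ### Optimality by summation over classes of observations -/

lemma card_now_le [NeZero n] {k m : ℕ} (hk : 1 ≤ k) {t : Fin n}
    (E : Finset (Equiv.Perm (Fin n)))
    (hE : ∀ π π', observed (P n k) t π = observed (P n k) t π' → π ∈ E → π' ∈ E)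
    (hm : ∀ π ∈ E, (free n k (seen π t)).card = m) :
    (E.filter fun π => π t = 0).card ≤ (E.filter fun π => π (tau n k π) = 0).card := by
  rcases Nat.eq_zero_or_pos m with rfl | hpos
  · refine Finset.card_le_card fun π hπ => ?_
    obtain ⟨hπ, ht⟩ := Finset.mem_filter.1 hπ
    refine Finset.mem_filter.2 ⟨hπ, ?_⟩
    rw [tau_eq_of_free_eq_empty ht (Finset.card_eq_zero.1 (hm π hπ)), ht]
  · exact Nat.le_of_mul_le_mul_left
      ((mul_card_now_le hk E hE hm).trans (card_later_le hk E hE hm)) hpos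

lemma card_win_le [NeZero n] {k : ℕ} (hk : 1 ≤ k) {σ : Equiv.Perm (Fin n) → Fin n}
    (hσ : IsSelectorStoppingTime (P n k) σ) :
    (Finset.univ.filter fun π : Equiv.Perm (Fin n) => π (σ π) = 0).card ≤
      (Finset.univ.filter fun π : Equiv.Perm (Fin n) => π (tau n k π) = 0).card := by
  classical
  -- On a fibre of `F` the stopping time and the number of free positions are constant, and the
  -- fibre is closed under equality of observations, as `card_now_le` requires.
  set F : Equiv.Perm (Fin n) → Fin n × ℕ := fun π => (σ π, (free n k (seen π (σ π))).card) with hF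
  have hmaps : ∀ s : Finset (Equiv.Perm (Fin n)),
      Set.MapsTo F s (Finset.univ.image F : Finset (Fin n × ℕ)) := fun s π _ => by simp
  rw [Finset.card_eq_sum_card_fiberwise (hmaps _), Finset.card_eq_sum_card_fiberwise (hmaps _)]
  refine Finset.sum_le_sum fun b _ => ?_
  obtain ⟨t, m⟩ := b
  have key := card_now_le (t := t) (m := m) hk (Finset.univ.filter fun π => F π = (t, m))
    (fun π π' h hπ => ?_) (fun π hπ => ?_)
  · refine le_trans (le_of_eq ?_) (key.trans (le_of_eq ?_))
    · rw [Finset.filter_filter, Finset.filter_filter]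
      refine congrArg _ (Finset.filter_congr fun π _ => ?_)
      rw [and_comm]
      refine and_congr_right fun h => ?_
      rw [(Prod.mk.inj h).1]
    · rw [Finset.filter_filter, Finset.filter_filter]
      simp only [and_comm]
  · simp only [hF, Finset.mem_filter, Finset.mem_univ, true_and, Prod.mk.injEq] at hπ ⊢
    obtain ⟨rfl, rfl⟩ := hπ
    have h1 := hσ.eq_of_observed_eq h
    rw [h1]
    exact ⟨rfl, (card_free_eq_of_observed_eq hk h).symm⟩
  · simp only [hF, Finset.mem_filter, Finset.mem_univ, true_and, Prod.mk.injEq] at hπ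
    obtain ⟨rfl, rfl⟩ := hπ
    rfl

lemma isOptimal_tau [NeZero n] {k : ℕ} (hk : 1 ≤ k) : IsOptimal (P n k) (tau n k) := by
  refine ⟨isSelectorStoppingTime_tau hk, fun σ hσ => ?_⟩
  have hwin : ∀ τ : Equiv.Perm (Fin n) → Fin n,
      win (P n k) τ = ((Finset.univ.filter fun π => π (τ π) = 0 : Finset (Equiv.Perm (Fin n))) :
        Set (Equiv.Perm (Fin n))) := by
    intro τ
    ext π
    simp [win, isSink_P_iff hk]
  have : MeasurableSingletonClass (Equiv.Perm (Fin n)) := ⟨fun _ => trivial⟩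
  rw [uniformPerm, uniformOn_univ, uniformOn_univ, hwin, hwin, Measure.count_apply_finset,
    Measure.count_apply_finset]
  exact ENNReal.div_le_div_right (Nat.cast_le.2 (card_win_le hk hσ)) _

end PathPower

/-- The `k`-th power of the directed path with `n` vertices has a unique sink, and `τₙ` is an
optimal stopping time for choosing it. -/
theorem mainTheorem1 (n k : ℕ) [NeZero n] (hk : 1 ≤ k) (hkn : k < n) :
    (∃! v : Fin n, PathPower.IsSink (PathPower.P n k) v) ∧
      PathPower.IsOptimal (PathPower.P n k) (PathPower.tau n k) :=
  ⟨⟨0, (PathPower.isSink_P_iff hk).2 rfl, fun _ h => (PathPower.isSink_P_iff hk).1 h⟩,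
    PathPower.isOptimal_tau hk⟩
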